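/- **Conventions.** A *parametrization* of a set $X$ is a map $P\colon U_P\to X$ from an open subset $U_P$ of some $\mathbb R^n$ ($n=\dim U_P\ge 0$); a *diffeology* on $X$ is a set of parametrizations (the *plots*) that contains the constant ones, is closed under precomposition with smooth maps between open subsets of Euclidean spaces, and is local. A map between diffeological spaces is *smooth* if it carries plots to plots. For a set $\mathcal G$ of parametrizations, $\langle\mathcal G\rangle$ is the diffeology of all parametrizations which near each point of their domain are constant or of the form $Q\circ f$ with $Q\in\mathcal G$ and $f$ smooth; $\mathcal G$ is a *generating family* of a diffeology $\mathcal D$ if $\mathcal G\subset\mathcal D$ and $\langle\mathcal G\rangle=\mathcal D$. For a diffeological space $(X,\mathcal D)$ let $T_2(X)=\operatorname{colim}_{P\in\mathcal D}\,U_P\times\mathbb R^{\dim U_P}\times\mathbb R^{\dim U_P}$, where $(x,v,w)$ over $P=Q\circ f$ is identified with $(f(x),Jf_x v,Jf_x w)$ over $Q$. A *weak Riemannian metric* is a map $g\colon T_2(X)\to\mathbb R$ such that $g(P)_x(v,w):=g([x,v,w]_P)$ is a smooth symmetric covariant $2$-tensor on $U_P$ with $g(P)_x(v,v)\ge 0$,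 for every plot $P$. It is *definite with respect to* $\mathcal G$ if $\mathcal G$ is a generating family of $\mathcal D$ and, for all $P\in\mathcal G$, $x\in U_P$, $v\in\mathbb R^{\dim U_P}$, $g(P)_x(v,v)=0$ implies $v=0$. **Setting.** Let $M$ be a non-empty closed oriented $d$-dimensional manifold with a (positive, nowhere vanishing, smooth) volume form $\mathrm{vol}_M$, regarded as a diffeological space whose plots are the smooth maps from open subsets of Euclidean spaces. Let $N$ be a diffeological space with a weak Riemannian metric $g_N$ which is definite with respect to a generating family $\mathcal G$ of the diffeology of $N$. Let $\mathcal D_{\mathrm{func}}$ be the functional diffeology on the set $C^\infty(M,N)$ of smooth maps: $P$ is a plot iff $\mathrm{ad}(P)\colon U_P\times M\to N$, $(r,m)\mapsto P(r)(m)$, is smooth. For $P\in\mathcal D_{\mathrm{func}}$, $r\in U_P$, $v,w\in\mathbb R^{\dim U_P}$ and $m\in M$ put $$\Theta(P)(v,w)(r,m)=g_N\bigl(\mathrm{ad}(P)\circ(1\times\varphi^{-1})\bigr)_{(r,\varphi(m))}\bigl((v,0),(w,0)\bigr),$$ where $\varphi$ is any chart of $M$ at $m$ (the value does not depend on $\varphi$),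 and $$g(P)_r(v,w)=\int_M\Theta(P)(v,w)(r,m)\,\mathrm{vol}_M ,$$ which defines a map $g$ on $T_2(C^\infty(M,N),\mathcal D_{\mathrm{func}})$. Let $\mathcal F_{\mathcal G}$ be the set of all $P\in\mathcal D_{\mathrm{func}}$ such that for all $r\in U_P$ and $m\in M$ there is an open neighbourhood $W$ of $r$ in $U_P$ with $(\mathrm{ev}_m\circ P)|_W\in\mathcal G$, where $\mathrm{ev}_m(f)=f(m)$; and let $\mathcal D'=\langle\mathcal F_{\mathcal G}\rangle\subset\mathcal D_{\mathrm{func}}$. **Theorem 5.7.** The functions $\Theta(P)(v,w)(r,\cdot)\colon M\to\mathbb R$ are smooth (so that the integrals above exist), the restriction of $g$ to $\mathcal D'$, that is, its composite with $T_2(\mathrm{id})\colon T_2(C^\infty(M,N),\mathcal D')\to T_2(C^\infty(M,N),\mathcal D_{\mathrm{func}})$, is a weak Riemannian metric on $(C^\infty(M,N),\mathcal D')$, and this metric is definite with respect to the generating family $\mathcal F_{\mathcal G}$ of $\mathcal D'$. -/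

import Mathlib

open Set TopologicalSpace MeasureTheory
open scoped Manifold ContDiff

noncomputable section

/-- The Euclidean space `ℝⁿ`. -/
abbrev Euc (n : ℕ) : Type := EuclideanSpace ℝ (Fin n)

/-! ### Parametrizations and diffeologies

Families of plots with arbitrary open domains are essential below (membership of a restriction
`P|_W` in a given family is not invariant under changing the domain), so plots are
parametrizations defined on arbitrary open subsets of Euclidean spaces. -/

/-- A parametrization of `X`: a map to `X` from a domain, i.e. an open subset of some `ℝⁿ`. -/
structure Param (X : Type*) where
  /-- the dimension of the ambient Euclidean space of the domain -/
  dim : ℕ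
  /-- the domain -/
  dom : Opens (Euc dim)
  /-- the map -/
  toFun : dom → X

namespace Param

variable {X Y : Type*}

/-- The constant parametrization on `U` with value `x`. -/
def const {n : ℕ} (U : Opens (Euc n)) (x : X) : Param X := ⟨n, U, fun _ => x⟩

/-- The composite `P ∘ F : U → X` for a map `F` carrying the domain `U` into the domain of `P`. -/
def pullback (P : Param X) {n : ℕ} (U : Opens (Euc n)) (F : Euc n → Euc P.dim)
    (hF : MapsTo F U P.dom) : Param X :=
  ⟨n, U, fun x => P.toFun ⟨F x, hF x.2⟩⟩

/-- The restriction `P|_V` to a smaller domain `V`. -/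
def restrict (P : Param X) (V : Opens (Euc P.dim)) (hV : V ≤ P.dom) : Param X :=
  ⟨P.dim, V, fun x => P.toFun ⟨x, hV x.2⟩⟩

/-- The composite `f ∘ P`. -/
def map (f : X → Y) (P : Param X) : Param Y := ⟨P.dim, P.dom, fun x => f (P.toFun x)⟩

end Param

/-- A diffeology on `X`: a set of parametrizations satisfying covering, compatibility and
locality. A smooth map between domains `U → V` is given by a total function which is smooth on `U`
and carries `U` into `V`. -/
@[ext]
structure DiffeologyOn (X : Type*) where
  /-- the plots -/
  plots : Set (Param X)
  const_mem : ∀ {n : ℕ} (U : Opens (Euc n)) (x : X), Param.const U x ∈ plots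
  pullback_mem : ∀ P ∈ plots, ∀ {n : ℕ} (U : Opens (Euc n)) (F : Euc n → Euc P.dim)
    (hF : MapsTo F U P.dom), ContDiffOn ℝ ∞ F U → P.pullback U F hF ∈ plots
  locality : ∀ P : Param X,
    (∀ r ∈ P.dom, ∃ (V : Opens (Euc P.dim)) (hV : V ≤ P.dom), r ∈ V ∧ P.restrict V hV ∈ plots) →
    P ∈ plots

section Smooth

variable {X Y : Type*}

/-- Smooth maps between diffeological spaces: they carry plots to plots. -/
def IsDSmooth (DX : DiffeologyOn X) (DY : DiffeologyOn Y) (f : X → Y) : Prop :=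
  ∀ P ∈ DX.plots, P.map f ∈ DY.plots

/-- The set `C^∞(X, Y)` of smooth maps. -/
def SmoothMaps (DX : DiffeologyOn X) (DY : DiffeologyOn Y) : Type _ :=
  {f : X → Y // IsDSmooth DX DY f}

/-- The evaluation map `ev_x : C^∞(X, Y) → Y`. -/
def SmoothMaps.ev {DX : DiffeologyOn X} {DY : DiffeologyOn Y} (x : X) (f : SmoothMaps DX DY) : Y :=
  f.1 x

/-- The diffeology `⟨G⟩` generated by a set `G` of parametrizations: the parametrizations which
locally are constant or factor smoothly through a member of `G`. -/
def DiffeologyOn.generate (G : Set (Param X)) : DiffeologyOn X where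
  plots := {P | ∀ r ∈ P.dom, ∃ (V : Opens (Euc P.dim)) (hV : V ≤ P.dom), r ∈ V ∧
    ((∃ x : X, P.restrict V hV = Param.const V x) ∨
      ∃ Q ∈ G, ∃ (F : Euc P.dim → Euc Q.dim) (hF : MapsTo F V Q.dom),
        ContDiffOn ℝ ∞ F V ∧ P.restrict V hV = Q.pullback V F hF)}
  const_mem U x := fun _ hr => ⟨U, le_rfl, hr, Or.inl ⟨x, rfl⟩⟩
  pullback_mem := by
    intro P hP n U F hF hFs r hr
    obtain ⟨V, hV, hrV, h⟩ := hP (F r) (hF hr)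
    have ho : IsOpen ((U : Set (Euc n)) ∩ F ⁻¹' V) := hFs.continuousOn.isOpen_inter_preimage U.2 V.2
    refine ⟨⟨_, ho⟩, fun x hx => hx.1, ⟨hr, hrV⟩, ?_⟩
    rcases h with ⟨x, hx⟩ | ⟨Q, hQ, F', hF', hs, hx⟩
    · refine Or.inl ⟨x, ?_⟩
      simp only [Param.restrict, Param.const, Param.mk.injEq, heq_eq_eq, true_and,
        funext_iff] at hx
      exact congrArg (Param.mk _ _) (funext fun y => hx ⟨F y.1, y.2.2⟩)
    · refine Or.inr ⟨Q, hQ, F' ∘ F, fun y hy => hF' hy.2,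
        hs.comp (hFs.mono fun y hy => hy.1) fun y hy => hy.2, ?_⟩
      simp only [Param.restrict, Param.pullback, Param.mk.injEq, heq_eq_eq, true_and,
        funext_iff] at hx
      exact congrArg (Param.mk _ _) (funext fun y => hx ⟨F y.1, y.2.2⟩)
  locality := by
    intro P h r hr
    obtain ⟨V, hV, hrV, h⟩ := h r hr
    obtain ⟨W, hW, hrW, h⟩ := h r hrV
    exact ⟨W, fun x hx => hV (hW hx), hrW, h⟩

/-- `G` is a generating family of the diffeology `D`. -/
def IsGeneratingFamily (D : DiffeologyOn X) (G : Set (Param X)) : Prop :=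
  G ⊆ D.plots ∧ DiffeologyOn.generate G = D

theorem DiffeologyOn.restrict_mem (D : DiffeologyOn X) {P : Param X} (hP : P ∈ D.plots)
    (V : Opens (Euc P.dim)) (hV : V ≤ P.dom) : P.restrict V hV ∈ D.plots :=
  D.pullback_mem P hP V id hV contDiffOn_id

theorem DiffeologyOn.generate_subset (D : DiffeologyOn X) {G : Set (Param X)} (hG : G ⊆ D.plots) :
    (DiffeologyOn.generate G).plots ⊆ D.plots := by
  intro P hP
  refine D.locality P fun r hr => ?_
  obtain ⟨V, hV, hrV, ⟨x, hx⟩ | ⟨Q, hQ, F, hF, hs, hx⟩⟩ := hP r hr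
  · exact ⟨V, hV, hrV, hx ▸ D.const_mem V x⟩
  · exact ⟨V, hV, hrV, hx ▸ D.pullback_mem Q (hG hQ) V F hF hs⟩

/-- The product diffeology. -/
def DiffeologyOn.prod (DX : DiffeologyOn X) (DY : DiffeologyOn Y) : DiffeologyOn (X × Y) where
  plots := {P | P.map Prod.fst ∈ DX.plots ∧ P.map Prod.snd ∈ DY.plots}
  const_mem U x := ⟨DX.const_mem U x.1, DY.const_mem U x.2⟩
  pullback_mem P hP _ U F hF hs :=
    ⟨DX.pullback_mem (P.map Prod.fst) hP.1 U F hF hs, DY.pullback_mem (P.map Prod.snd) hP.2 U F hF hs⟩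
  locality P h := by
    refine ⟨DX.locality _ fun r hr => ?_, DY.locality _ fun r hr => ?_⟩
    · obtain ⟨V, hV, hrV, h⟩ := h r hr
      exact ⟨V, hV, hrV, h.1⟩
    · obtain ⟨V, hV, hrV, h⟩ := h r hr
      exact ⟨V, hV, hrV, h.2⟩

end Smooth

section Standard

/-- A map smooth on a domain, corestricted to another domain, is smooth as a map of manifolds. -/
theorem contMDiff_opens_mk {n m : ℕ} {U : Opens (Euc n)} {V : Opens (Euc m)} {F : Euc n → Euc m}
    (hF : MapsTo F U V) (hs : ContDiffOn ℝ ∞ F U) :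
    ContMDiff (𝓡 n) (𝓡 m) ∞ (fun x : U => (⟨F x, hF x.2⟩ : V)) := by
  rw [← ContMDiff.subtypeVal_comp_iff]
  exact hs.contMDiffOn.comp_contMDiff contMDiff_subtype_val fun x => x.2

variable {d : ℕ} (M : Type*) [TopologicalSpace M] [ChartedSpace (Euc d) M]

/-- The standard diffeology of a manifold: the maps from domains which are smooth in the usual
sense. -/
def DiffeologyOn.standard : DiffeologyOn M where
  plots := {P | ContMDiff (𝓡 P.dim) (𝓡 d) ∞ P.toFun}
  const_mem _ _ := contMDiff_const
  pullback_mem P hP _ _ _ hF hs := by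
    have h : ContMDiff (𝓡 P.dim) (𝓡 d) ∞ P.toFun := hP
    exact h.comp (contMDiff_opens_mk hF hs)
  locality := by
    rintro P h ⟨r, hr⟩
    obtain ⟨V, hV, hrV, h⟩ := h r hr
    exact ((contDiffWithinAt_localInvariantProp ∞).liftPropAt_iff_comp_inclusion hV
      P.toFun ⟨r, hrV⟩).2 (h ⟨r, hrV⟩)

variable {M}

theorem DiffeologyOn.mem_standard {P : Param M} :
    P ∈ (DiffeologyOn.standard (d := d) M).plots ↔ ContMDiff (𝓡 P.dim) (𝓡 d) ∞ P.toFun :=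
  Iff.rfl

end Standard

section Functional

variable {X Y : Type*}

/-- The adjoint `ad(P) : U_P × X → Y` of a parametrization of `C^∞(X, Y)`. -/
def Param.adjoint {DX : DiffeologyOn X} {DY : DiffeologyOn Y} (P : Param (SmoothMaps DX DY)) :
    P.dom × X → Y :=
  fun z => (P.toFun z.1).1 z.2

/-- The functional diffeology on `C^∞(X, Y)`: its plots are the parametrizations with smooth
adjoint, where a domain carries its standard diffeology. -/
def DiffeologyOn.functional (DX : DiffeologyOn X) (DY : DiffeologyOn Y) :
    DiffeologyOn (SmoothMaps DX DY) where
  plots := {P | IsDSmooth ((DiffeologyOn.standard (d := P.dim) P.dom).prod DX) DY P.adjoint}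
  const_mem U f := fun Q hQ => f.2 (Q.map Prod.snd) hQ.2
  pullback_mem := by
    intro P hP n U F hF hs Q hQ
    have h1 := DiffeologyOn.mem_standard.1 hQ.1
    refine hP (Q.map fun z : U × X => ((⟨F z.1, hF z.1.2⟩ : P.dom), z.2)) ⟨?_, hQ.2⟩
    exact DiffeologyOn.mem_standard.2 ((contMDiff_opens_mk hF hs).comp h1)
  locality := by
    intro P h Q hQ
    refine DY.locality _ fun r hr => ?_
    obtain ⟨V, hV, hrV, h⟩ := h (Q.toFun ⟨r, hr⟩).1 (Q.toFun ⟨r, hr⟩).1.2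
    have hc : ContMDiff (𝓡 Q.dim) (𝓡 P.dim) ∞ fun x : Q.dom => (Q.toFun x).1 :=
      DiffeologyOn.mem_standard.1 hQ.1
    have ho : IsOpen {x : Q.dom | ((Q.toFun x).1 : Euc P.dim) ∈ V} :=
      V.2.preimage (continuous_subtype_val.comp hc.continuous)
    let W : Opens (Euc Q.dim) :=
      ⟨Subtype.val '' {x : Q.dom | ((Q.toFun x).1 : Euc P.dim) ∈ V}, Q.dom.2.isOpenMap_subtype_val _ ho⟩
    have hW : W ≤ Q.dom := by
      rintro _ ⟨x, -, rfl⟩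
      exact x.2
    have hWV : ∀ x : W, ((Q.toFun ⟨x, hW x.2⟩).1 : Euc P.dim) ∈ V := by
      rintro ⟨_, ⟨x, hx, rfl⟩⟩
      exact hx
    refine ⟨W, hW, ⟨⟨r, hr⟩, hrV, rfl⟩, ?_⟩
    refine h ⟨Q.dim, W, fun x => ((⟨(Q.toFun ⟨x, hW x.2⟩).1, hWV x⟩ : V), (Q.toFun ⟨x, hW x.2⟩).2)⟩
      ⟨?_, DX.restrict_mem hQ.2 W hW⟩
    refine DiffeologyOn.mem_standard.2 ?_
    change ContMDiff (𝓡 Q.dim) (𝓡 P.dim) ∞ fun x : W =>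
      (⟨(Q.toFun ⟨x, hW x.2⟩).1, hWV x⟩ : V)
    rw [← ContMDiff.subtypeVal_comp_iff]
    have h3 : ContMDiff (𝓡 Q.dim) (𝓡 P.dim) ∞ fun x : W =>
        ((Q.toFun ⟨x, hW x.2⟩).1 : Euc P.dim) :=
      (contMDiff_subtype_val (U := P.dom)).comp (hc.comp (contMDiff_inclusion hW))
    exact h3

/-- The family `F_G` of those plots `P` of the functional diffeology such that, for all `r ∈ U_P`
and `x ∈ X`, some restriction of `ev_x ∘ P` to an open neighbourhood of `r` belongs to `G`. -/
def familyF (DX : DiffeologyOn X) (DY : DiffeologyOn Y) (G : Set (Param Y)) :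
    Set (Param (SmoothMaps DX DY)) :=
  {P | P ∈ (DiffeologyOn.functional DX DY).plots ∧
    ∀ r ∈ P.dom, ∀ x : X, ∃ (W : Opens (Euc P.dim)) (hW : W ≤ P.dom), r ∈ W ∧
      (P.restrict W hW).map (SmoothMaps.ev x) ∈ G}

end Functional

/-! ### Tangent functor and weak Riemannian metrics -/

section Metric

variable {X Y : Type*}

/-- The elements of `∐_P U_P × ℝ^{dim U_P} × ℝ^{dim U_P}`, where `P` runs over the plots. -/
structure PreTangent2 (D : DiffeologyOn X) where
  plot : Param X
  mem : plot ∈ D.plots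
  base : plot.dom
  fst : Euc plot.dim
  snd : Euc plot.dim

/-- The gluing relation of the colimit: if `F : U_P → U_Q` is smooth and `P = Q ∘ F`, then
`(x, v, w)` over `P` is identified with `(F x, JF_x v, JF_x w)` over `Q`. -/
inductive PreTangent2.Rel (D : DiffeologyOn X) : PreTangent2 D → PreTangent2 D → Prop
  | glue (Q : Param X) (hQ : Q ∈ D.plots) {n : ℕ} (U : Opens (Euc n)) (F : Euc n → Euc Q.dim)
      (hF : MapsTo F U Q.dom) (hs : ContDiffOn ℝ ∞ F U) (x : U) (v w : Euc n) :
      PreTangent2.Rel D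
        ⟨Q.pullback U F hF, D.pullback_mem Q hQ U F hF hs, x, v, w⟩
        ⟨Q, hQ, ⟨F x, hF x.2⟩, fderiv ℝ F x v, fderiv ℝ F x w⟩

/-- `T₂(X) = colim_P (U_P × ℝ^{dim U_P} × ℝ^{dim U_P})`, the colimit over the category of plots. -/
def Tangent2 (D : DiffeologyOn X) : Type _ := Quot (PreTangent2.Rel D)

/-- The element `[x, v, w]_P` of `T₂(X)`. -/
def Tangent2.mk {D : DiffeologyOn X} (P : Param X) (hP : P ∈ D.plots) (x : P.dom)
    (v w : Euc P.dim) : Tangent2 D :=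
  Quot.mk _ ⟨P, hP, x, v, w⟩

/-- The map `T₂(f) : T₂(X) → T₂(Y)` induced by a smooth map, `[x, v, w]_P ↦ [x, v, w]_{f ∘ P}`. -/
def Tangent2.map {DX : DiffeologyOn X} {DY : DiffeologyOn Y} (f : X → Y) (hf : IsDSmooth DX DY f) :
    Tangent2 DX → Tangent2 DY :=
  Quot.lift (fun a => Tangent2.mk (a.plot.map f) (hf _ a.mem) a.base a.fst a.snd) (by
    rintro _ _ ⟨Q, hQ, U, F, hF, hs, x, v, w⟩
    exact Quot.sound (PreTangent2.Rel.glue (Q.map f) (hf _ hQ) U F hF hs x v w))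

/-- A symmetric and positive (smooth) covariant `2`-tensor on a domain `U`. -/
structure IsSymmPosTensor {n : ℕ} (U : Opens (Euc n)) (t : U → Euc n → Euc n → ℝ) : Prop where
  smooth : ∀ v w, ContMDiff (𝓡 n) 𝓘(ℝ, ℝ) ∞ fun x => t x v w
  add_left : ∀ x v v' w, t x (v + v') w = t x v w + t x v' w
  smul_left : ∀ x (c : ℝ) v w, t x (c • v) w = c * t x v w
  symm : ∀ x v w, t x v w = t x w v
  nonneg : ∀ x v, 0 ≤ t x v v

/-- `g : T₂(X) → ℝ` is a weak Riemannian metric: for each plot `P` the composite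
`g(P)_x(v, w) = g [x, v, w]_P` is a symmetric and positive covariant `2`-tensor on `U_P`. -/
def IsWeakRiemannianMetric (D : DiffeologyOn X) (g : Tangent2 D → ℝ) : Prop :=
  ∀ (P : Param X) (hP : P ∈ D.plots),
    IsSymmPosTensor P.dom fun x v w => g (Tangent2.mk P hP x v w)

/-- `G` is a generating family of `D`, and the tensor `g(P)` is definite for every `P ∈ G`. -/
def IsDefiniteWithRespectTo (D : DiffeologyOn X) (g : Tangent2 D → ℝ) (G : Set (Param X)) : Prop :=
  IsGeneratingFamily D G ∧
    ∀ (P : Param X) (hP : P ∈ D.plots), P ∈ G → ∀ (x : P.dom) (v : Euc P.dim),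
      g (Tangent2.mk P hP x v v) = 0 → v = 0

end Metric

/-! ### Volume forms and integration -/

section Volume

variable {d : ℕ} (M : Type*) [TopologicalSpace M] [ChartedSpace (Euc d) M]

/-- The coefficient `vol(∂₁, …, ∂_d)` of a `d`-form in the chart `e`, as a function on `e.target`. -/
def formCoeff {M : Type*} [TopologicalSpace M] [ChartedSpace (Euc d) M]
    (vol : ∀ m : M, (TangentSpace (𝓡 d) m) [⋀^Fin d]→ₗ[ℝ] ℝ)
    (e : OpenPartialHomeomorph M (Euc d)) (x : Euc d) : ℝ :=
  vol (e.symm x) fun j => mfderiv (𝓡 d) (𝓡 d) e.symm x (EuclideanSpace.single j (1 : ℝ) : Euc d)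

/-- A volume form on the `d`-manifold `M`: a nowhere vanishing smooth `d`-form. -/
structure VolForm where
  /-- the alternating form on each tangent space -/
  form : ∀ m : M, (TangentSpace (𝓡 d) m) [⋀^Fin d]→ₗ[ℝ] ℝ
  smooth : ∀ e ∈ atlas (Euc d) M, ContDiffOn ℝ ∞ (formCoeff form e) e.target
  ne_zero : ∀ m, form m ≠ 0

variable [IsManifold (𝓡 d) ∞ M] [CompactSpace M] [T2Space M]

/-- A smooth partition of unity subordinate to the charts of `M`. -/
def chartPartition : SmoothPartitionOfUnity M (𝓡 d) M univ :=
  (SmoothPartitionOfUnity.exists_isSubordinate_chartAt_source (𝓡 d) M).choose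

theorem chartPartition_isSubordinate :
    (chartPartition (d := d) M).IsSubordinate fun x => (chartAt (Euc d) x).source :=
  (SmoothPartitionOfUnity.exists_isSubordinate_chartAt_source (𝓡 d) M).choose_spec

variable {M}

/-- The integral `∫_M f vol` of a function against a volume form on a closed manifold, oriented by
`vol`: the sum over a partition of unity `ρ` subordinate to the charts of the integrals of
`ρ_i f vol` in the charts. As `M` is oriented by `vol`, a chart is positively oriented at the points
where the coefficient `vol(∂₁, …, ∂_d)` is positive, whence the absolute value. -/
def VolForm.integral (vol : VolForm (d := d) M) (f : M → ℝ) : ℝ :=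
  ∑ᶠ i : M, ∫ x in (chartAt (Euc d) i).target,
    chartPartition (d := d) M i ((chartAt (Euc d) i).symm x) * f ((chartAt (Euc d) i).symm x) *
      |formCoeff vol.form (chartAt (Euc d) i) x|

end Volume

/-! ### The integrated metric on a mapping space -/

section Integrated

variable {d : ℕ} {M : Type*} [TopologicalSpace M] [ChartedSpace (Euc d) M]
  {N : Type*} {DN : DiffeologyOn N}

/-- The domain `U × V` in `ℝⁿ × ℝᵈ = ℝⁿ⁺ᵈ`. -/
def prodDomain {n : ℕ} (U : Opens (Euc n)) (V : Opens (Euc d)) : Opens (Euc (n + d)) :=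
  ⟨{z | (EuclideanSpace.finAddEquivProd (𝕜 := ℝ) z).1 ∈ U ∧
      (EuclideanSpace.finAddEquivProd (𝕜 := ℝ) z).2 ∈ V},
    (U.2.preimage (continuous_fst.comp (ContinuousLinearEquiv.continuous _))).inter
      (V.2.preimage (continuous_snd.comp (ContinuousLinearEquiv.continuous _)))⟩

/-- The point `(x, y)` of `ℝⁿ⁺ᵈ = ℝⁿ × ℝᵈ`. -/
def eucPair {n : ℕ} (x : Euc n) (y : Euc d) : Euc (n + d) :=
  (EuclideanSpace.finAddEquivProd (𝕜 := ℝ)).symm (x, y)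

theorem eucPair_mem {n : ℕ} {U : Opens (Euc n)} {V : Opens (Euc d)} {x : Euc n} {y : Euc d}
    (hx : x ∈ U) (hy : y ∈ V) : eucPair x y ∈ prodDomain U V := by
  have h : EuclideanSpace.finAddEquivProd (𝕜 := ℝ) (eucPair x y) = (x, y) :=
    (EuclideanSpace.finAddEquivProd (𝕜 := ℝ)).apply_symm_apply _
  exact ⟨by rw [h]; exact hx, by rw [h]; exact hy⟩

/-- The parametrization `ad(P) ∘ (1 × φ⁻¹) : U_P × φ(V) → N`, for a plot `P` of `C^∞(M, N)` and a
chart `φ : V → φ(V)` of `M`. -/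
def chartParam (P : Param (SmoothMaps (DiffeologyOn.standard (d := d) M) DN))
    (φ : OpenPartialHomeomorph M (Euc d)) : Param N :=
  ⟨P.dim + d, prodDomain P.dom ⟨φ.target, φ.open_target⟩, fun z =>
    P.adjoint (⟨(EuclideanSpace.finAddEquivProd (𝕜 := ℝ) z.1).1, z.2.1⟩,
      φ.symm (EuclideanSpace.finAddEquivProd (𝕜 := ℝ) z.1).2)⟩

theorem chartParam_mem [IsManifold (𝓡 d) ∞ M]
    {P : Param (SmoothMaps (DiffeologyOn.standard (d := d) M) DN)}
    (hP : P ∈ (DiffeologyOn.functional _ _).plots)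
    {φ : OpenPartialHomeomorph M (Euc d)} (hφ : φ ∈ atlas (Euc d) M) :
    chartParam P φ ∈ DN.plots := by
  let L : Euc (P.dim + d) ≃L[ℝ] Euc P.dim × Euc d := EuclideanSpace.finAddEquivProd (𝕜 := ℝ)
  let W := prodDomain P.dom (d := d) ⟨φ.target, φ.open_target⟩
  refine hP ⟨P.dim + d, W, fun z => (⟨(L z.1).1, z.2.1⟩, φ.symm (L z.1).2)⟩ ⟨?_, ?_⟩
  · refine DiffeologyOn.mem_standard.2 ?_
    exact contMDiff_opens_mk (U := W) (V := P.dom) (F := fun z => (L z).1) (fun z hz => hz.1)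
      (contDiff_fst.comp L.contDiff).contDiffOn
  · have h1 : ContMDiffOn (𝓡 d) (𝓡 d) ∞ φ.symm φ.target :=
      contMDiffOn_symm_of_mem_maximalAtlas (IsManifold.subset_maximalAtlas hφ)
    have h2 : ContMDiff (𝓡 (P.dim + d)) (𝓡 d) ∞ fun z : Euc (P.dim + d) => (L z).2 :=
      (contDiff_snd.comp L.contDiff).contMDiff
    refine DiffeologyOn.mem_standard.2 ?_
    have h3 : ContMDiff (𝓡 (P.dim + d)) (𝓡 d) ∞ fun z : W => φ.symm (L z.1).2 :=
      h1.comp_contMDiff (h2.comp contMDiff_subtype_val) fun z => z.2.2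
    exact h3

theorem ev_mem {P : Param (SmoothMaps (DiffeologyOn.standard (d := d) M) DN)}
    (hP : P ∈ (DiffeologyOn.functional _ _).plots) (m : M) :
    P.map (SmoothMaps.ev m) ∈ DN.plots :=
  hP ⟨P.dim, P.dom, fun x => (x, m)⟩ ⟨DiffeologyOn.mem_standard.2 contMDiff_id, DiffeologyOn.mem_standard.2 contMDiff_const⟩

variable [IsManifold (𝓡 d) ∞ M]

/-- `Θ(P)(v, w)(r, m) = g_N(ad(P) ∘ (1 × φ⁻¹))_{(r, φ m)}((v, 0), (w, 0))`, where `φ` is the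
preferred chart at `m`. -/
def theta (gN : Tangent2 DN → ℝ) (P : Param (SmoothMaps (DiffeologyOn.standard (d := d) M) DN))
    (hP : P ∈ (DiffeologyOn.functional _ _).plots) (v w : Euc P.dim) (r : P.dom) (m : M) : ℝ :=
  gN (Tangent2.mk (chartParam P (chartAt (Euc d) m)) (chartParam_mem hP (chart_mem_atlas _ m))
    ⟨eucPair r (chartAt (Euc d) m m), eucPair_mem r.2 (mem_chart_target _ m)⟩
    (eucPair v 0) (eucPair w 0))

/-- The value of `ev_m ∘ P` under `g_N` is given by the same formula in every chart `φ` at `m`. -/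
theorem mk_chartParam_eq {P : Param (SmoothMaps (DiffeologyOn.standard (d := d) M) DN)}
    (hP : P ∈ (DiffeologyOn.functional _ _).plots) (v w : Euc P.dim) (r : P.dom) (m : M)
    {φ : OpenPartialHomeomorph M (Euc d)} (hφ : φ ∈ atlas (Euc d) M) (hm : m ∈ φ.source)
    (hev : P.map (SmoothMaps.ev m) ∈ DN.plots) :
    Tangent2.mk (chartParam P φ) (chartParam_mem hP hφ)
        ⟨eucPair r (φ m), eucPair_mem r.2 (φ.map_source hm)⟩ (eucPair v 0) (eucPair w 0) =
      Tangent2.mk (P.map (SmoothMaps.ev m)) hev r v w := by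
  let L : Euc (P.dim + d) ≃L[ℝ] Euc P.dim × Euc d := EuclideanSpace.finAddEquivProd (𝕜 := ℝ)
  have hd : ∀ x : Euc P.dim, HasFDerivAt (fun y => L.symm (y, φ m))
      ((L.symm : Euc P.dim × Euc d →L[ℝ] Euc (P.dim + d)).comp
        (ContinuousLinearMap.inl ℝ (Euc P.dim) (Euc d))) x := fun x =>
    HasFDerivAt.comp (g := L.symm) x L.symm.hasFDerivAt (hasFDerivAt_prodMk_left x (φ m))
  have hF : MapsTo (fun y : Euc P.dim => L.symm (y, φ m)) P.dom
      (prodDomain P.dom (d := d) ⟨φ.target, φ.open_target⟩) :=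
    fun y hy => eucPair_mem (V := ⟨φ.target, φ.open_target⟩) hy (φ.map_source hm)
  have hs : ContDiffOn ℝ ∞ (fun y : Euc P.dim => L.symm (y, φ m)) P.dom :=
    (L.symm.contDiff.comp (contDiff_prodMk_left (φ m))).contDiffOn
  have key := Quot.sound (PreTangent2.Rel.glue (D := DN) (chartParam P φ) (chartParam_mem hP hφ)
    P.dom _ hF hs r v w)
  have e1 : ((chartParam P φ).pullback P.dom (fun y : Euc P.dim => L.symm (y, φ m)) hF).toFun =
      (P.map (SmoothMaps.ev m)).toFun := by
    funext y
    have h3 : ∀ (q : Euc P.dim × Euc d) (hq : q.1 ∈ P.dom), q = (y.1, φ m) →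
        P.adjoint (⟨q.1, hq⟩, φ.symm q.2) = SmoothMaps.ev m (P.toFun y) := by
      rintro _ _ rfl
      simp only [Param.adjoint, SmoothMaps.ev, φ.left_inv hm]
      rfl
    exact h3 _ _ (L.apply_symm_apply _)
  have h4 : ∀ u : Euc P.dim, eucPair u 0 = fderiv ℝ (fun y : Euc P.dim => L.symm (y, φ m)) r u :=
    fun u => by rw [(hd r).fderiv]; rfl
  have h5 : ∀ (f f' : P.dom → N) (hf : (⟨P.dim, P.dom, f⟩ : Param N) ∈ DN.plots)
      (hf' : (⟨P.dim, P.dom, f'⟩ : Param N) ∈ DN.plots), f = f' →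
      Tangent2.mk (D := DN) ⟨P.dim, P.dom, f⟩ hf r v w =
        Tangent2.mk (D := DN) ⟨P.dim, P.dom, f'⟩ hf' r v w := by
    rintro f _ _ _ rfl
    rfl
  exact ((congrArg₂ (fun a b => Tangent2.mk (chartParam P φ) (chartParam_mem hP hφ)
    ⟨eucPair r (φ m), eucPair_mem r.2 (φ.map_source hm)⟩ a b) (h4 v) (h4 w)).trans key.symm).trans
    (h5 _ _ _ hev e1)

/-- `Θ(P)(v, w)(r, m) = g_N(ev_m ∘ P)_r(v, w)`; in particular `Θ` does not depend on the charts. -/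
theorem theta_eq (gN : Tangent2 DN → ℝ)
    {P : Param (SmoothMaps (DiffeologyOn.standard (d := d) M) DN)}
    (hP : P ∈ (DiffeologyOn.functional _ _).plots) (v w : Euc P.dim) (r : P.dom) (m : M) :
    theta gN P hP v w r m =
      gN (Tangent2.mk (P.map (SmoothMaps.ev m)) (ev_mem hP m) r v w) :=
  congrArg gN (mk_chartParam_eq hP v w r m (chart_mem_atlas _ m) (mem_chart_source _ m) _)

variable [CompactSpace M] [T2Space M]

/-- The metric `g(P)_r(v, w) = ∫_M Θ(P)(v, w)(r, ·) vol_M` on `C^∞(M, N)` with its functional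
diffeology, as a map on `T₂(C^∞(M, N))`. -/
def integratedMetric (vol : VolForm (d := d) M) (gN : Tangent2 DN → ℝ) :
    Tangent2 (DiffeologyOn.functional (DiffeologyOn.standard (d := d) M) DN) → ℝ :=
  Quot.lift (fun a => vol.integral (theta gN a.plot a.mem a.fst a.snd a.base)) (by
    rintro _ _ ⟨Q, hQ, U, F, hF, hs, x, v, w⟩
    refine congrArg vol.integral (funext fun m => ?_)
    rw [theta_eq, theta_eq]
    exact congrArg gN (Quot.sound (PreTangent2.Rel.glue (Q.map (SmoothMaps.ev m)) (ev_mem hQ m)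
      U F hF hs x v w)))

end Integrated

section SubDiffeology

variable {X Y : Type*}

/-- The diffeology `D' = ⟨F_G⟩` on `C^∞(X, Y)`. -/
def subDiffeology (DX : DiffeologyOn X) (DY : DiffeologyOn Y) (G : Set (Param Y)) :
    DiffeologyOn (SmoothMaps DX DY) :=
  DiffeologyOn.generate (familyF DX DY G)

/-- The identity map from `C^∞(X, Y)` with `D'` to `C^∞(X, Y)` with the functional diffeology is
smooth. -/
theorem isDSmooth_id_subDiffeology (DX : DiffeologyOn X) (DY : DiffeologyOn Y) (G : Set (Param Y)) :
    IsDSmooth (subDiffeology DX DY G) (DiffeologyOn.functional DX DY) id :=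
  fun _ hP => (DiffeologyOn.functional DX DY).generate_subset (fun _ h => h.1) hP

/-- The restriction to `D'` of a metric on `C^∞(X, Y)`: its pullback by the identity map. -/
def restrictMetric {DX : DiffeologyOn X} {DY : DiffeologyOn Y} (G : Set (Param Y))
    (g : Tangent2 (DiffeologyOn.functional DX DY) → ℝ) : Tangent2 (subDiffeology DX DY G) → ℝ :=
  g ∘ Tangent2.map id (isDSmooth_id_subDiffeology DX DY G)

end SubDiffeology

end

/-!
The value `Θ(P)(v, w)(r, m)` is `g_N(ev_m ∘ P)_r(v, w)`, so for fixed `m` it is a symmetric positive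
bilinear form in `(v, w)`. In a chart `φ` of `M` it is a coefficient of the tensor
`g_N(ad(P) ∘ (1 × φ⁻¹))`, so it is smooth jointly in `(r, m)` (`contDiffOn_thetaExt`). The pointwise
properties pass to the integral over `M`, and smoothness in `r` is differentiation under the
integral sign over a closed manifold (`VolForm.contDiffOn_integral`). Thus the integral is already
a weak Riemannian metric for the functional diffeology
(`isWeakRiemannianMetric_integratedMetric`), and the restriction to the smaller diffeology
generated by the family `F_G` inherits this.

Definiteness: if `g(P)_r(v, v) = 0`, then the continuous nonnegative function `Θ(P)(v, v)(r, ·)` has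
vanishing integral against a nowhere vanishing volume form, so it is identically zero
(`VolForm.eq_zero_of_integral_eq_zero`). For `P` in `F_G` and any point `m` of `M`, the plot
`ev_m ∘ P` belongs to `G` near `r`, and definiteness of `g_N` with respect to `G` gives `v = 0`.
-/

/-! ### Integrals of compactly supported functions over open sets -/

section Euclidean

variable {E : Type*} [NormedAddCommGroup E] [MeasurableSpace E] [BorelSpace E] {μ : Measure E}
  [IsFiniteMeasureOnCompacts μ]

theorem ContinuousOn.integrableOn_of_eq_zero_off_compact {V K : Set E}
    (hV : IsOpen V) (hK : IsCompact K) (hKV : K ⊆ V) {h : E → ℝ} (hc : ContinuousOn h V)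
    (h0 : ∀ y ∈ V, y ∉ K → h y = 0) : IntegrableOn h V μ :=
  ((hc.mono hKV).integrableOn_compact hK).of_forall_sdiff_eq_zero hV.measurableSet
    fun y hy => h0 y hy.1 hy.2

/-- Differentiation under the integral sign: if `h p` is smooth in `(p, y)` and vanishes for `y`
outside a fixed compact set, then `∫_V h(p, y) c(y)` is smooth in `p` for every continuous weight
`c`. The integral is the value at `0` of the convolution of `c`, cut off to the compact set, with
the reflection of `h p`. -/
theorem contDiffOn_setIntegral_mul [NormedSpace ℝ E] {P : Type*} [NormedAddCommGroup P]
    [NormedSpace ℝ P]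
    {U : Set P} (hU : IsOpen U) {V K : Set E} (hV : IsOpen V) (hK : IsCompact K) (hKV : K ⊆ V)
    {h : P → E → ℝ} (hs : ContDiffOn ℝ ∞ (fun q : P × E => h q.1 q.2) (U ×ˢ V))
    (h0 : ∀ p ∈ U, ∀ y ∈ V, y ∉ K → h p y = 0) {c : E → ℝ} (hc : ContinuousOn c V) :
    ContDiffOn ℝ ∞ (fun p => ∫ y in V, h p y * c y ∂μ) U := by
  have hf : LocallyIntegrable (K.indicator c) μ :=
    ((integrable_indicator_iff hK.measurableSet).2
      ((hc.mono hKV).integrableOn_compact hK)).locallyIntegrable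
  have hg : ContDiffOn ℝ ∞ (fun q : P × E => K.indicator (h q.1) (-q.2)) (U ×ˢ univ) := by
    rintro ⟨p, y⟩ ⟨hp : p ∈ U, -⟩
    refine ContDiffAt.contDiffWithinAt ?_
    -- Near a point of `K` the cut-off is the identity, since `h` vanishes on `V` outside `K`.
    by_cases hy : -y ∈ K
    · have h1 : ContDiffAt ℝ ∞ (fun q : P × E => h q.1 (-q.2)) (p, y) :=
        ContDiffAt.comp (g := fun q : P × E => h q.1 q.2) (p, y)
          (hs.contDiffAt ((hU.prod hV).mem_nhds ⟨hp, hKV hy⟩))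
          (contDiff_fst.prodMk contDiff_snd.neg).contDiffAt
      refine h1.congr_of_eventuallyEq ?_
      have ho : IsOpen {q : P × E | q.1 ∈ U ∧ -q.2 ∈ V} :=
        (hU.preimage continuous_fst).inter (hV.preimage continuous_snd.neg)
      filter_upwards [ho.mem_nhds (show (p, y) ∈ _ from ⟨hp, hKV hy⟩)] with q hq
      by_cases hqK : -q.2 ∈ K
      · rw [indicator_of_mem hqK]
      · rw [indicator_of_notMem hqK, h0 _ hq.1 _ hq.2 hqK]
    · refine (contDiffAt_const (c := (0 : ℝ))).congr_of_eventuallyEq ?_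
      have ho : IsOpen {q : P × E | -q.2 ∈ Kᶜ} :=
        hK.isClosed.isOpen_compl.preimage continuous_snd.neg
      filter_upwards [ho.mem_nhds (show (p, y) ∈ _ from hy)] with q hq
      exact indicator_of_notMem hq _
  have key := contDiffOn_convolution_right_with_param_comp (μ := μ) (ContinuousLinearMap.mul ℝ ℝ)
    (v := fun _ : P => (0 : E)) (n := ⊤) contDiffOn_const (k := -K)
    (g := fun p y => K.indicator (h p) (-y)) hU hK.neg
    (fun p x _ hx => indicator_of_notMem (by simpa using hx) _) hf hg
  refine key.congr fun p hp => ?_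
  rw [convolution_def, ← integral_indicator hV.measurableSet]
  refine integral_congr_ae (Filter.Eventually.of_forall fun y => ?_)
  by_cases hyK : y ∈ K
  · simp [hyK, hKV hyK, mul_comm]
  · by_cases hyV : y ∈ V
    · simp [hyK, hyV, h0 p hp y hyV hyK]
    · simp [hyK, hyV]

end Euclidean

/-! ### Integration against a volume form on a closed manifold -/

section Volume

variable {d : ℕ} {M : Type*} [TopologicalSpace M] [ChartedSpace (Euc d) M]

theorem VolForm.continuousOn_abs_formCoeff (vol : VolForm (d := d) M) (i : M) :
    ContinuousOn (fun x => |formCoeff vol.form (chartAt (Euc d) i) x|)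
      (chartAt (Euc d) i).target :=
  (vol.smooth _ (chart_mem_atlas _ i)).continuousOn.abs

variable [IsManifold (𝓡 d) ∞ M]

/-- The derivative of `e.symm` is invertible, so it carries the standard basis to a basis of the
tangent space, on which a nonzero top form does not vanish. -/
theorem VolForm.formCoeff_ne_zero (vol : VolForm (d := d) M)
    {e : OpenPartialHomeomorph M (Euc d)} (he : e ∈ atlas (Euc d) M) {x : Euc d}
    (hx : x ∈ e.target) : formCoeff vol.form e x ≠ 0 := by
  have hm : e.MDifferentiable (𝓡 d) (𝓡 d) :=
    have : IsManifold (𝓡 d) 1 M := .of_le (n := ∞) (by simp)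
    mdifferentiable_of_mem_atlas he
  let b : Module.Basis (Fin d) ℝ (TangentSpace (𝓡 d) (e.symm x)) :=
    (EuclideanSpace.basisFun (Fin d) ℝ).toBasis.map (hm.symm.mfderiv hx).toLinearEquiv
  have h := (AlternatingMap.map_basis_ne_zero_iff b (vol.form (e.symm x))).2 (vol.ne_zero _)
  have hb : ⇑b = fun j => mfderiv (𝓡 d) (𝓡 d) e.symm x
      (EuclideanSpace.single j (1 : ℝ) : Euc d) := by
    funext j
    exact (Module.Basis.map_apply _ _ j).trans (congrArg (mfderiv (𝓡 d) (𝓡 d) e.symm x)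
      ((congrFun (EuclideanSpace.basisFun (Fin d) ℝ).coe_toBasis j).trans
        (EuclideanSpace.basisFun_apply (Fin d) ℝ j)))
  rwa [hb] at h

variable [CompactSpace M] [T2Space M]

theorem finite_support_chartPartition :
    {i | (Function.support (chartPartition (d := d) M i)).Nonempty}.Finite :=
  (chartPartition (d := d) M).locallyFinite.finite_nonempty_of_compact

/-- The integral as a sum over a finite set of charts which does not depend on the integrand. -/
theorem VolForm.integral_eq_sum (vol : VolForm (d := d) M) (f : M → ℝ) :
    vol.integral f = ∑ i ∈ (finite_support_chartPartition (d := d) (M := M)).toFinset,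
      ∫ x in (chartAt (Euc d) i).target,
        chartPartition (d := d) M i ((chartAt (Euc d) i).symm x) * f ((chartAt (Euc d) i).symm x) *
          |formCoeff vol.form (chartAt (Euc d) i) x| := by
  refine finsum_eq_sum_of_support_subset _ fun i hi => ?_
  rw [Finite.coe_toFinset, mem_ofPred_eq]
  by_contra h
  rw [Function.support_nonempty_iff, not_not] at h
  exact hi (by simp [h])

/-- The image in the chart at `i` of the support of the `i`-th function of the partition of unity;
the `i`-th integrand of `VolForm.integral` vanishes outside it. -/
def chartSupport (i : M) : Set (Euc d) :=
  chartAt (Euc d) i '' tsupport (chartPartition (d := d) M i)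

theorem isCompact_chartSupport (i : M) : IsCompact (chartSupport (d := d) i) :=
  (isClosed_tsupport _).isCompact.image_of_continuousOn
    ((chartAt (Euc d) i).continuousOn.mono (chartPartition_isSubordinate M i))

theorem chartSupport_subset (i : M) : chartSupport (d := d) i ⊆ (chartAt (Euc d) i).target := by
  rintro _ ⟨m, hm, rfl⟩
  exact (chartAt (Euc d) i).map_source (chartPartition_isSubordinate M i hm)

theorem chartPartition_symm_eq_zero {i : M} {y : Euc d} (hy : y ∈ (chartAt (Euc d) i).target)
    (hyK : y ∉ chartSupport (d := d) i) :
    chartPartition (d := d) M i ((chartAt (Euc d) i).symm y) = 0 :=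
  image_eq_zero_of_notMem_tsupport fun h => hyK ⟨_, h, (chartAt (Euc d) i).right_inv hy⟩

namespace VolForm

variable (vol : VolForm (d := d) M)

theorem continuousOn_integrand (i : M) {f : M → ℝ} (hf : Continuous f) :
    ContinuousOn (fun x => chartPartition (d := d) M i ((chartAt (Euc d) i).symm x) *
      f ((chartAt (Euc d) i).symm x) * |formCoeff vol.form (chartAt (Euc d) i) x|)
      (chartAt (Euc d) i).target :=
  ((((chartPartition (d := d) M i).contMDiff.continuous.comp_continuousOn
    (chartAt (Euc d) i).continuousOn_symm)).mul
      (hf.comp_continuousOn (chartAt (Euc d) i).continuousOn_symm)).mul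
    (vol.continuousOn_abs_formCoeff i)

theorem integrableOn_integrand (i : M) {f : M → ℝ} (hf : Continuous f) :
    IntegrableOn (fun x => chartPartition (d := d) M i ((chartAt (Euc d) i).symm x) *
      f ((chartAt (Euc d) i).symm x) * |formCoeff vol.form (chartAt (Euc d) i) x|)
      (chartAt (Euc d) i).target :=
  (vol.continuousOn_integrand i hf).integrableOn_of_eq_zero_off_compact
    (chartAt (Euc d) i).open_target (isCompact_chartSupport i) (chartSupport_subset i)
    fun y hy hyK => by rw [chartPartition_symm_eq_zero hy hyK, zero_mul, zero_mul]

theorem integrand_nonneg (i : M) {f : M → ℝ} (hf : ∀ m, 0 ≤ f m) (x : Euc d) :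
    0 ≤ chartPartition (d := d) M i ((chartAt (Euc d) i).symm x) *
      f ((chartAt (Euc d) i).symm x) * |formCoeff vol.form (chartAt (Euc d) i) x| :=
  mul_nonneg (mul_nonneg ((chartPartition (d := d) M).nonneg i _) (hf _)) (abs_nonneg _)

theorem integral_add {f g : M → ℝ} (hf : Continuous f) (hg : Continuous g) :
    vol.integral (fun m => f m + g m) = vol.integral f + vol.integral g := by
  simp only [integral_eq_sum, ← Finset.sum_add_distrib]
  refine Finset.sum_congr rfl fun i _ => ?_
  rw [← MeasureTheory.integral_add (vol.integrableOn_integrand i hf)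
    (vol.integrableOn_integrand i hg)]
  simp only [mul_add, add_mul]

theorem integral_const_mul (c : ℝ) (f : M → ℝ) :
    vol.integral (fun m => c * f m) = c * vol.integral f := by
  simp only [integral_eq_sum, Finset.mul_sum, ← MeasureTheory.integral_const_mul]
  simp only [mul_left_comm _ c, mul_assoc]

theorem integral_nonneg {f : M → ℝ} (hf : ∀ m, 0 ≤ f m) : 0 ≤ vol.integral f := by
  rw [integral_eq_sum]
  exact Finset.sum_nonneg fun i _ => MeasureTheory.integral_nonneg (vol.integrand_nonneg i hf)

/-- Some chart of the partition of unity has positive weight at `m`; the integrand in that chart is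
continuous and nonnegative with vanishing integral, so it vanishes at `m`. -/
theorem eq_zero_of_integral_eq_zero {f : M → ℝ} (hc : Continuous f) (hf : ∀ m, 0 ≤ f m)
    (h : vol.integral f = 0) (m : M) : f m = 0 := by
  obtain ⟨i, hi⟩ := (chartPartition (d := d) M).exists_pos_of_mem (mem_univ m)
  let e := chartAt (Euc d) i
  have hm : m ∈ e.source :=
    chartPartition_isSubordinate M i (subset_tsupport _ (Function.mem_support.2 hi.ne'))
  rw [integral_eq_sum, Finset.sum_eq_zero_iff_of_nonneg fun i _ =>
    MeasureTheory.integral_nonneg (vol.integrand_nonneg i hf)] at h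
  have h1 := h i ((Finite.mem_toFinset _).2 ⟨m, hi.ne'⟩)
  rw [setIntegral_eq_zero_iff_of_nonneg_ae (Filter.Eventually.of_forall (vol.integrand_nonneg i hf))
    (vol.integrableOn_integrand i hc)] at h1
  have h2 := Measure.eqOn_open_of_ae_eq h1 e.open_target (vol.continuousOn_integrand i hc)
    continuousOn_const (e.map_source hm)
  have h3 : formCoeff vol.form e (e m) ≠ 0 :=
    vol.formCoeff_ne_zero (chart_mem_atlas _ i) (e.map_source hm)
  have h4 : chartAt (Euc d) i = e := rfl
  simpa [h4, e.left_inv hm, hi.ne', h3] using h2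

/-- Differentiation under the integral sign on a closed manifold. In each chart the weight
`|vol(∂₁, …, ∂_d)|` enters only as a continuous factor, independent of the parameter. -/
theorem contDiffOn_integral {E : Type*} [NormedAddCommGroup E] [NormedSpace ℝ E] {U : Set E}
    (hU : IsOpen U) {f : E → M → ℝ}
    (hf : ∀ e ∈ atlas (Euc d) M,
      ContDiffOn ℝ ∞ (fun q : E × Euc d => f q.1 (e.symm q.2)) (U ×ˢ e.target)) :
    ContDiffOn ℝ ∞ (fun p => vol.integral (f p)) U := by
  simp only [integral_eq_sum]
  refine ContDiffOn.sum fun i _ => ?_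
  let e := chartAt (Euc d) i
  have hρ : ContDiffOn ℝ ∞ (fun y => chartPartition (d := d) M i (e.symm y)) e.target :=
    ((chartPartition (d := d) M i).contMDiff.comp_contMDiffOn
      (contMDiffOn_symm_of_mem_maximalAtlas
        (IsManifold.subset_maximalAtlas (chart_mem_atlas _ i)))).contDiffOn
  refine contDiffOn_setIntegral_mul hU e.open_target (isCompact_chartSupport i)
    (chartSupport_subset i) (h := fun p y => chartPartition (d := d) M i (e.symm y) * f p (e.symm y))
    ?_ ?_ (vol.continuousOn_abs_formCoeff i)
  · exact (hρ.comp contDiffOn_snd fun q hq => hq.2).mul (hf e (chart_mem_atlas _ i))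
  · intro p _ y hy hyK
    rw [chartPartition_symm_eq_zero hy hyK, zero_mul]

end VolForm

end Volume

/-! ### The function `Θ` and the integrated metric -/

/-- A function smooth on a domain as a manifold is smooth in the usual sense, for any extension `T`
of it to the ambient space. -/
theorem contDiffOn_of_contMDiff_opens {n : ℕ} {U : Opens (Euc n)} {t : U → ℝ}
    (ht : ContMDiff (𝓡 n) 𝓘(ℝ, ℝ) ∞ t) {T : Euc n → ℝ} (hT : ∀ x : U, T x = t x) :
    ContDiffOn ℝ ∞ T U := fun x hx => by
  have h : ContMDiffAt (𝓡 n) 𝓘(ℝ, ℝ) ∞ (fun y : U => T y) ⟨x, hx⟩ := by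
    simpa only [hT] using ht ⟨x, hx⟩
  exact (contMDiffAt_subtype_iff.1 h).contDiffAt.contDiffWithinAt

theorem ContDiffOn.contMDiff_opens {n : ℕ} {U : Opens (Euc n)} {T : Euc n → ℝ}
    (hT : ContDiffOn ℝ ∞ T U) : ContMDiff (𝓡 n) 𝓘(ℝ, ℝ) ∞ fun x : U => T x :=
  hT.contMDiffOn.comp_contMDiff contMDiff_subtype_val fun x => x.2

section Theta

variable {d : ℕ} {M : Type*} [TopologicalSpace M] [ChartedSpace (Euc d) M]
  [IsManifold (𝓡 d) ∞ M] {N : Type*} {DN : DiffeologyOn N} {gN : Tangent2 DN → ℝ}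
  {P : Param (SmoothMaps (DiffeologyOn.standard (d := d) M) DN)}

open Classical in
/-- `Θ(P)(v, w)(r, m)` as a function of a point `r` of the whole space `ℝⁿ ⊇ U_P`, extended by zero
to `r ∉ U_P`. -/
noncomputable def thetaExt (gN : Tangent2 DN → ℝ) (hP : P ∈ (DiffeologyOn.functional _ _).plots)
    (v w : Euc P.dim) (r : Euc P.dim) (m : M) : ℝ :=
  if hr : r ∈ P.dom then theta gN P hP v w ⟨r, hr⟩ m else 0

theorem thetaExt_coe (hP : P ∈ (DiffeologyOn.functional _ _).plots) (v w : Euc P.dim)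
    (r : P.dom) : thetaExt gN hP v w r = theta gN P hP v w r := by
  funext m
  exact dif_pos r.2

/-- In a chart `φ` of `M`, `Θ(P)(v, w)` is jointly smooth in both variables: by independence of the
chart it is the coefficient of the tensor `g_N(ad(P) ∘ (1 × φ⁻¹))` at `(v, 0)` and `(w, 0)`. -/
theorem contDiffOn_thetaExt (hgN : IsWeakRiemannianMetric DN gN)
    (hP : P ∈ (DiffeologyOn.functional _ _).plots) (v w : Euc P.dim)
    {φ : OpenPartialHomeomorph M (Euc d)} (hφ : φ ∈ atlas (Euc d) M) :
    ContDiffOn ℝ ∞ (fun q : Euc P.dim × Euc d => thetaExt gN hP v w q.1 (φ.symm q.2))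
      ((P.dom : Set (Euc P.dim)) ×ˢ φ.target) := by
  let L : Euc (P.dim + d) ≃L[ℝ] Euc P.dim × Euc d := EuclideanSpace.finAddEquivProd (𝕜 := ℝ)
  have h1 : ContDiffOn ℝ ∞ (fun z => thetaExt gN hP v w (L z).1 (φ.symm (L z).2))
      (prodDomain P.dom (d := d) ⟨φ.target, φ.open_target⟩) := by
    refine contDiffOn_of_contMDiff_opens
      ((hgN (chartParam P φ) (chartParam_mem hP hφ)).smooth (eucPair v 0) (eucPair w 0)) ?_
    rintro ⟨z, hz⟩
    obtain ⟨⟨x, y⟩, rfl⟩ := L.symm.surjective z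
    have hx : x ∈ P.dom := by simpa [L] using hz.1
    have hy : y ∈ φ.target := by simpa [L] using hz.2
    have h2 := congrArg gN (mk_chartParam_eq hP v w ⟨x, hx⟩ (φ.symm y) hφ (φ.map_target hy)
      (ev_mem hP _))
    rw [← theta_eq gN hP] at h2
    simp only [L.apply_symm_apply]
    rw [show thetaExt gN hP v w x (φ.symm y) = _ from congrFun (thetaExt_coe hP v w ⟨x, hx⟩) _,
      ← h2]
    have h3 : (⟨eucPair x (φ (φ.symm y)), eucPair_mem hx (φ.map_source (φ.map_target hy))⟩ :
        (chartParam P φ).dom) = ⟨L.symm (x, y), hz⟩ := by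
      refine Subtype.ext ?_
      change eucPair x (φ (φ.symm y)) = L.symm (x, y)
      rw [φ.right_inv hy]
      rfl
    exact congrArg (fun b => gN (Tangent2.mk (chartParam P φ) (chartParam_mem hP hφ) b
      (eucPair v 0) (eucPair w 0))) h3
  refine (h1.comp L.symm.contDiff.contDiffOn ?_).congr ?_
  · rintro ⟨x, y⟩ ⟨hx, hy⟩
    exact eucPair_mem (V := ⟨φ.target, φ.open_target⟩) hx hy
  · rintro q -
    simp

theorem contMDiff_theta (hgN : IsWeakRiemannianMetric DN gN)
    (hP : P ∈ (DiffeologyOn.functional _ _).plots) (v w : Euc P.dim) (r : P.dom) :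
    ContMDiff (𝓡 d) 𝓘(ℝ, ℝ) ∞ (theta gN P hP v w r) := by
  intro m
  let e := chartAt (Euc d) m
  have h1 : ContDiffOn ℝ ∞ (fun y : Euc d => theta gN P hP v w r (e.symm y)) e.target := by
    rw [← thetaExt_coe]
    exact (contDiffOn_thetaExt hgN hP v w (chart_mem_atlas _ m)).comp
      (contDiff_prodMk_right (r : Euc P.dim)).contDiffOn fun y hy => ⟨r.2, hy⟩
  have h2 : ContMDiffOn (𝓡 d) 𝓘(ℝ, ℝ) ∞ (fun x => theta gN P hP v w r (e.symm (e x))) e.source :=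
    h1.contMDiffOn.comp (contMDiffOn_of_mem_maximalAtlas
      (IsManifold.chart_mem_maximalAtlas m)) fun x hx => e.map_source hx
  exact (h2.congr fun x hx => by rw [e.left_inv hx]).contMDiffAt (chart_source_mem_nhds _ m)

variable [CompactSpace M] [T2Space M]

theorem isWeakRiemannianMetric_integratedMetric (vol : VolForm (d := d) M)
    (hgN : IsWeakRiemannianMetric DN gN) :
    IsWeakRiemannianMetric (DiffeologyOn.functional (DiffeologyOn.standard (d := d) M) DN)
      (integratedMetric vol gN) := by
  intro P hP
  have hev := fun m => hgN (P.map (SmoothMaps.ev m)) (ev_mem hP m)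
  change IsSymmPosTensor P.dom fun r v w => vol.integral (theta gN P hP v w r)
  refine ⟨fun v w => ?_, fun r v v' w => ?_, fun r c v w => ?_, fun r v w => ?_, fun r v => ?_⟩
  · simp only [← thetaExt_coe]
    exact (vol.contDiffOn_integral P.dom.2
      fun e he => contDiffOn_thetaExt hgN hP v w he).contMDiff_opens
  · rw [← vol.integral_add (contMDiff_theta hgN hP v w r).continuous
      (contMDiff_theta hgN hP v' w r).continuous]
    refine congrArg vol.integral (funext fun m => ?_)
    simp only [theta_eq]
    exact (hev m).add_left r v v' w
  · rw [← vol.integral_const_mul]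
    refine congrArg vol.integral (funext fun m => ?_)
    simp only [theta_eq]
    exact (hev m).smul_left r c v w
  · refine congrArg vol.integral (funext fun m => ?_)
    simp only [theta_eq]
    exact (hev m).symm r v w
  · refine vol.integral_nonneg fun m => ?_
    rw [theta_eq]
    exact (hev m).nonneg r v

theorem eq_zero_of_integratedMetric_eq_zero [Nonempty M] (vol : VolForm (d := d) M)
    (hgN : IsWeakRiemannianMetric DN gN) {G : Set (Param N)}
    (hG : IsDefiniteWithRespectTo DN gN G)
    (hPF : P ∈ familyF (DiffeologyOn.standard (d := d) M) DN G) (r : P.dom) (v : Euc P.dim)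
    (h : integratedMetric vol gN (Tangent2.mk P hPF.1 r v v) = 0) : v = 0 := by
  obtain ⟨m⟩ := ‹Nonempty M›
  have hev := ev_mem hPF.1 m
  have h1 : theta gN P hPF.1 v v r m = 0 := by
    refine vol.eq_zero_of_integral_eq_zero (contMDiff_theta hgN hPF.1 v v r).continuous
      (fun m' => ?_) h m
    rw [theta_eq]
    exact (hgN _ (ev_mem hPF.1 m')).nonneg r v
  rw [theta_eq] at h1
  obtain ⟨W, hW, hrW, hWG⟩ := hPF.2 r r.2 m
  let s : W := ⟨r, hrW⟩
  -- The gluing relation along the inclusion `W → U_P` identifies the two tangent elements.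
  have h2 : Tangent2.mk ((P.restrict W hW).map (SmoothMaps.ev m))
      (DN.restrict_mem (P := P.map (SmoothMaps.ev m)) hev W hW) s v v =
        Tangent2.mk (P.map (SmoothMaps.ev m)) hev r v v := by
    have h3 := Quot.sound (PreTangent2.Rel.glue (D := DN) (P.map (SmoothMaps.ev m)) hev W id
      (fun x hx => hW hx) contDiffOn_id s v v)
    have h4 : fderiv ℝ (id : Euc P.dim → Euc P.dim) r v = v := by rw [fderiv_id]; rfl
    change _ = Tangent2.mk (P.map (SmoothMaps.ev m)) hev r
      (fderiv ℝ (id : Euc P.dim → Euc P.dim) r v) (fderiv ℝ (id : Euc P.dim → Euc P.dim) r v) at h3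
    rwa [h4] at h3
  exact hG.2 _ _ hWG s v ((congrArg gN h2).trans h1)

end Theta

theorem DiffeologyOn.subset_generate {X : Type*} (G : Set (Param X)) :
    G ⊆ (DiffeologyOn.generate G).plots := fun P hP _ hr =>
  ⟨P.dom, le_rfl, hr, Or.inr ⟨P, hP, id, fun _ hx => hx, contDiffOn_id, rfl⟩⟩

theorem theorem5p7 {d : ℕ} {M : Type*} [TopologicalSpace M] [ChartedSpace (Euc d) M]
    [IsManifold (𝓡 d) ∞ M] [CompactSpace M] [T2Space M] [Nonempty M] (vol : VolForm (d := d) M)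
    {N : Type*} (DN : DiffeologyOn N) (gN : Tangent2 DN → ℝ)
    (hgN : IsWeakRiemannianMetric DN gN)
    (G : Set (Param N)) (hG : IsDefiniteWithRespectTo DN gN G) :
    (∀ (P : Param (SmoothMaps (DiffeologyOn.standard (d := d) M) DN))
        (hP : P ∈ (DiffeologyOn.functional _ _).plots) (v w : Euc P.dim) (r : P.dom),
        ContMDiff (𝓡 d) 𝓘(ℝ, ℝ) ∞ (theta gN P hP v w r)) ∧
      IsWeakRiemannianMetric (subDiffeology (DiffeologyOn.standard (d := d) M) DN G)
        (restrictMetric G (integratedMetric vol gN)) ∧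
      IsDefiniteWithRespectTo (subDiffeology (DiffeologyOn.standard (d := d) M) DN G)
        (restrictMetric G (integratedMetric vol gN))
        (familyF (DiffeologyOn.standard (d := d) M) DN G) :=
  ⟨fun _ hP v w r => contMDiff_theta hgN hP v w r,
    fun P hP => isWeakRiemannianMetric_integratedMetric vol hgN P
      (isDSmooth_id_subDiffeology _ DN G P hP),
    ⟨DiffeologyOn.subset_generate _, rfl⟩,
    fun _ _ hPF r v h => eq_zero_of_integratedMetric_eq_zero vol hgN hG hPF r v h⟩
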